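/- Let $m,n\ge 0$ be integers. Let $\mathcal H_m$ be the Hilbert space of $m$ bosonic modes, with orthonormal Fock basis $\{|\boldsymbol k\rangle\}_{\boldsymbol k=(k_1,\dots,k_m)\in\mathbb N^m}$, and write $|\boldsymbol k|=\sum_{i=1}^m k_i$. A state is a unit vector of $\mathcal H_m$. For $\boldsymbol\alpha\in\mathbb C^m$, the $m$-mode coherent state is $|\boldsymbol\alpha\rangle=|\alpha_1\rangle\otimes\cdots\otimes|\alpha_m\rangle$ with $|\alpha\rangle=e^{-|\alpha|^2/2}\sum_{k\ge 0}\frac{\alpha^k}{\sqrt{k!}}|k\rangle$. The approximate coherent state rank $\kappa(\boldsymbol\psi)\in\mathbb N\cup\{\infty\}$ of a state $|\boldsymbol\psi\rangle$ is the smallest $r$ such that for every $\varepsilon>0$ there is a state of the form $|\boldsymbol\phi_\varepsilon\rangle=\sum_{j=1}^r c_j|\boldsymbol\alpha_j\rangle$, with $c_j\in\mathbb C$ and $|\boldsymbol\alpha_j\rangle$ coherent states, such that $|\langle\boldsymbol\psi|\boldsymbol\phi_\varepsilon\rangle|^2\ge 1-\varepsilon$ (and $\kappa(\boldsymbol\psi)=\infty$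 if there is no such $r$). Theorem. Let $|\boldsymbol\psi\rangle=\sum_{|\boldsymbol k|\le n}c_{\boldsymbol k}|\boldsymbol k\rangle$ be a state that is a superposition of $m$-mode Fock states with total number of bosons at most $n$, and suppose that $c_{\boldsymbol k}\neq 0$ for at least one $\boldsymbol k$ with $|\boldsymbol k|=n$. Then $\kappa(\boldsymbol\psi)\ge n+1$. -/

import Mathlib

noncomputable section

/-- The Hilbert space of `m` bosonic modes, in its Fock basis: square-summable families of complex
amplitudes indexed by the occupation numbers `(n₁, …, nₘ) ∈ ℕᵐ`. -/
abbrev FockSpace (m : ℕ) : Type := lp (fun _ : Fin m → ℕ => ℂ) 2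

/-- The `m`-mode Fock state `|n₁, …, nₘ⟩`. -/
def fockState {m : ℕ} (k : Fin m → ℕ) : FockSpace m := lp.single 2 k (1 : ℂ)

/-- The Fock amplitude `⟨k|α⟩ = exp (-|α|² / 2) * α ^ k / √(k!)` of the single-mode coherent state
of amplitude `α`. -/
def coherentAmplitude (α : ℂ) (k : ℕ) : ℂ :=
  (Real.exp (-(‖α‖ ^ 2) / 2) : ℂ) * (α ^ k / (Real.sqrt (k.factorial : ℝ) : ℂ))

theorem norm_coherentAmplitude_sq (α : ℂ) (k : ℕ) :
    ‖coherentAmplitude α k‖ ^ 2 =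
      Real.exp (-(‖α‖ ^ 2)) * ((‖α‖ ^ 2) ^ k / (k.factorial : ℝ)) := by
  have h : Real.exp (-(‖α‖ ^ 2) / 2) ^ 2 = Real.exp (-(‖α‖ ^ 2)) := by
    rw [← Real.exp_nat_mul]
    congr 1
    push_cast
    ring
  have hs : Real.sqrt (k.factorial : ℝ) ^ 2 = (k.factorial : ℝ) := Real.sq_sqrt (by positivity)
  rw [coherentAmplitude, norm_mul, norm_div, norm_pow, Complex.norm_real, Complex.norm_real,
    Real.norm_of_nonneg (Real.exp_pos _).le, Real.norm_of_nonneg (Real.sqrt_nonneg _), mul_pow,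
    div_pow, h, hs]
  ring

theorem hasSum_norm_coherentAmplitude_sq (α : ℂ) :
    HasSum (fun k : ℕ => ‖coherentAmplitude α k‖ ^ 2) 1 := by
  simp only [norm_coherentAmplitude_sq]
  have h := (NormedSpace.expSeries_div_hasSum_exp (𝔸 := ℝ) (‖α‖ ^ 2)).mul_left
    (Real.exp (-(‖α‖ ^ 2)))
  rwa [← Real.exp_eq_exp_ℝ, ← Real.exp_add, neg_add_cancel, Real.exp_zero] at h

/-- The amplitudes of a tensor product of coherent states are square-summable. -/
theorem memℓp_coherentAmplitude {m : ℕ} (α : Fin m → ℂ) :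
    Memℓp (fun k : Fin m → ℕ => ∏ i, coherentAmplitude (α i) (k i)) 2 := by
  rw [memℓp_gen_iff (by norm_num)]
  have hr : (2 : ENNReal).toReal = ((2 : ℕ) : ℝ) := by norm_num
  simp only [hr, Real.rpow_natCast, norm_prod, ← Finset.prod_pow]
  refine summable_of_sum_le (c := 1) (fun k => by positivity) fun s => ?_
  calc ∑ k ∈ s, ∏ i, ‖coherentAmplitude (α i) (k i)‖ ^ 2
      ≤ ∑ k ∈ Fintype.piFinset (fun i => s.image fun k => k i),
          ∏ i, ‖coherentAmplitude (α i) (k i)‖ ^ 2 := by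
        refine Finset.sum_le_sum_of_subset_of_nonneg (fun k hk => ?_) fun k _ _ => by positivity
        rw [Fintype.mem_piFinset]
        exact fun i => Finset.mem_image_of_mem _ hk
    _ = ∏ i, ∑ j ∈ s.image (fun k => k i), ‖coherentAmplitude (α i) j‖ ^ 2 :=
        (Finset.prod_univ_sum (fun i => s.image fun k => k i)
          fun i j => ‖coherentAmplitude (α i) j‖ ^ 2).symm
    _ ≤ 1 := by
        refine Finset.prod_le_one (fun i _ => by positivity) fun i _ => ?_
        have h := hasSum_norm_coherentAmplitude_sq (α i)
        rw [← h.tsum_eq]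
        exact h.summable.sum_le_tsum _ fun j _ => sq_nonneg _

/-- The `m`-mode coherent state `|α₁⟩ ⊗ ⋯ ⊗ |αₘ⟩`. -/
def coherentState {m : ℕ} (α : Fin m → ℂ) : FockSpace m :=
  ⟨fun k => ∏ i, coherentAmplitude (α i) (k i), memℓp_coherentAmplitude α⟩

/-- The fidelity `|⟨ψ|φ⟩|²` of two pure states (unit vectors). -/
def fidelity {m : ℕ} (ψ φ : FockSpace m) : ℝ := ‖inner ℂ ψ φ‖ ^ 2

/-- `ψ` can be approximated, to arbitrarily high fidelity, by states (unit vectors) that are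
superpositions of `r` coherent states. -/
def IsApproxByCoherent {m : ℕ} (ψ : FockSpace m) (r : ℕ) : Prop :=
  ∀ ε : ℝ, 0 < ε → ∃ (c : Fin r → ℂ) (α : Fin r → Fin m → ℂ) (φ : FockSpace m),
    φ = ∑ j, c j • coherentState (α j) ∧ ‖φ‖ = 1 ∧ 1 - ε ≤ fidelity ψ φ

/-- The approximate coherent state rank of a state (unit vector) `ψ`: the smallest `r` for which
`ψ` is approximated by superpositions of `r` coherent states, and `⊤` if there is no such `r`. -/
def approxCoherentStateRank {m : ℕ} (ψ : FockSpace m) : ℕ∞ :=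
  ⨅ (r : ℕ) (_ : IsApproxByCoherent ψ r), (r : ℕ∞)

/-- The finite set of all occupation numbers of `m` modes with at most `n` bosons in total. -/
def occupationsLE (m n : ℕ) : Finset (Fin m → ℕ) :=
  {k ∈ Fintype.piFinset fun _ : Fin m => Finset.range (n + 1) | ∑ i, k i ≤ n}

theorem mem_occupationsLE {m n : ℕ} (k : Fin m → ℕ) : k ∈ occupationsLE m n ↔ ∑ i, k i ≤ n := by
  simp only [occupationsLE, Finset.mem_filter, Fintype.mem_piFinset, Finset.mem_range,
    and_iff_right_iff_imp]
  intro h i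
  have := Finset.single_le_sum (f := k) (fun _ _ => Nat.zero_le _) (Finset.mem_univ i)
  omega

end

/-! Scaling Fock amplitudes by `√(k!)` turns those of a coherent state into a constant times the
monomial `α ^ k`, which is multiplicative in `k`. A matrix of scaled amplitudes at `a i + b j` thus
has rank at most one on a coherent state, and at most `r` on a superposition of `r` of them. If `r ≤
n`, its determinant of size `n + 1` vanishes there and, by continuity, on all limits. On `ψ`, a
suitable such determinant is nonzero, because amplitudes above degree `n` vanish while one of degree
`n` does not. -/

/-- Below a vector `k` of natural numbers there are vectors of every smaller total degree. -/
theorem exists_le_sum_eq {ι : Type*} [Fintype ι] (k : ι → ℕ) {d : ℕ} (hd : d ≤ ∑ i, k i) :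
    ∃ a : ι → ℕ, a ≤ k ∧ ∑ i, a i = d := by
  classical
  induction hd using Nat.decreasingInduction with
  | self => exact ⟨k, le_rfl, rfl⟩
  | of_succ d _ ih =>
    obtain ⟨a, hak, ha⟩ := ih
    obtain ⟨i, -, hi⟩ : ∃ i ∈ Finset.univ, a i ≠ 0 := by
      by_contra! h
      rw [Finset.sum_eq_zero h] at ha
      omega
    refine ⟨Function.update a i (a i - 1), fun j => ?_, ?_⟩
    · have : a j ≤ k j := hak j
      rcases eq_or_ne j i with rfl | hj
      · simp only [Function.update_self]
        omega
      · simpa [hj] using this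
    · have h := Finset.add_sum_erase Finset.univ a (Finset.mem_univ i)
      rw [Finset.sum_update_of_mem (Finset.mem_univ i), Finset.sdiff_singleton_eq_erase]
      omega

/-- A square matrix that factors through a space of smaller dimension is singular. -/
theorem Matrix.det_mul_eq_zero_of_card_lt {K ι κ : Type*} [Field K] [Fintype ι] [DecidableEq ι]
    [Fintype κ] (A : Matrix ι κ K) (B : Matrix κ ι K) (h : Fintype.card κ < Fintype.card ι) :
    (A * B).det = 0 := by
  by_contra hdet
  have hr := Matrix.rank_of_isUnit (A * B)
    ((Matrix.isUnit_iff_isUnit_det _).2 (isUnit_iff_ne_zero.2 hdet))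
  have h₁ := (Matrix.rank_mul_le_left A B).trans (Matrix.rank_le_card_width A)
  omega

noncomputable section

/-- The Taylor coefficient `√(k!) ⟨k|x⟩` of the Bargmann function of `x`. -/
def bargmannMoment {m : ℕ} (x : FockSpace m) (k : Fin m → ℕ) : ℂ :=
  (∏ i, (Real.sqrt ((k i).factorial : ℝ) : ℂ)) * x k

theorem continuous_bargmannMoment {m : ℕ} (k : Fin m → ℕ) :
    Continuous fun x : FockSpace m => bargmannMoment x k :=
  continuous_const.mul (lp.evalCLM ℂ (fun _ : Fin m → ℕ => ℂ) 2 k).continuous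

theorem bargmannMoment_coherentState {m : ℕ} (α : Fin m → ℂ) (k : Fin m → ℕ) :
    bargmannMoment (coherentState α) k =
      (∏ i, (Real.exp (-(‖α i‖ ^ 2) / 2) : ℂ)) * ∏ i, α i ^ k i := by
  change _ * ∏ i, coherentAmplitude (α i) (k i) = _
  rw [← Finset.prod_mul_distrib, ← Finset.prod_mul_distrib]
  refine Finset.prod_congr rfl fun i _ => ?_
  have h : (Real.sqrt ((k i).factorial : ℝ) : ℂ) ≠ 0 :=
    Complex.ofReal_ne_zero.2 (Real.sqrt_ne_zero'.2 (by positivity))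
  rw [coherentAmplitude]
  field_simp

theorem bargmannMoment_sum_smul {m r : ℕ} (c : Fin r → ℂ) (x : Fin r → FockSpace m)
    (k : Fin m → ℕ) :
    bargmannMoment (∑ j, c j • x j) k = ∑ j, c j * bargmannMoment (x j) k := by
  simp only [bargmannMoment, lp.coeFn_sum, Finset.sum_apply, lp.coeFn_smul, Pi.smul_apply,
    smul_eq_mul, Finset.mul_sum]
  exact Finset.sum_congr rfl fun j _ => mul_left_comm _ _ _

/-- The Hankel-type matrix of the moments at `a i + b j`. -/
def momentMatrix {m d : ℕ} (a b : Fin d → Fin m → ℕ) (x : FockSpace m) :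
    Matrix (Fin d) (Fin d) ℂ :=
  Matrix.of fun i j => bargmannMoment x (a i + b j)

theorem continuous_det_momentMatrix {m d : ℕ} (a b : Fin d → Fin m → ℕ) :
    Continuous fun x : FockSpace m => (momentMatrix a b x).det :=
  Continuous.matrix_det (continuous_matrix fun _ _ => continuous_bargmannMoment _)

/-- Moment matrices of a superposition of `r` coherent states have rank at most `r`. -/
theorem det_momentMatrix_eq_zero {m d r : ℕ} (hr : r < d) (a b : Fin d → Fin m → ℕ)
    (c : Fin r → ℂ) (α : Fin r → Fin m → ℂ) :
    (momentMatrix a b (∑ j, c j • coherentState (α j))).det = 0 := by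
  have h : momentMatrix a b (∑ j, c j • coherentState (α j)) =
      Matrix.of (fun i j => c j * (∏ l, (Real.exp (-(‖α j l‖ ^ 2) / 2) : ℂ)) *
        ∏ l, α j l ^ a i l) * Matrix.of (fun j i => ∏ l, α j l ^ b i l) := by
    ext i j
    simp only [momentMatrix, Matrix.of_apply, Matrix.mul_apply, bargmannMoment_sum_smul,
      bargmannMoment_coherentState, Pi.add_apply, pow_add, Finset.prod_mul_distrib, mul_assoc]
  rw [h]
  exact Matrix.det_mul_eq_zero_of_card_lt _ _ (by simpa using hr)

theorem sum_smul_fockState_apply {m : ℕ} (s : Finset (Fin m → ℕ)) (c : (Fin m → ℕ) → ℂ)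
    (k : Fin m → ℕ) :
    (∑ l ∈ s, c l • fockState l : FockSpace m) k = if k ∈ s then c k else 0 := by
  classical
  rw [lp.coeFn_sum, Finset.sum_apply]
  simp [fockState, lp.single_apply, Pi.single_apply]

/-- For a state of degree `n` with a nonzero amplitude at a `k` of degree `n`, some moment matrix
of size `n + 1` is triangular with nonzero diagonal. -/
theorem exists_det_momentMatrix_ne_zero {m n : ℕ} (c : (Fin m → ℕ) → ℂ) {k : Fin m → ℕ}
    (hk : ∑ i, k i = n) (hck : c k ≠ 0) :
    ∃ a b : Fin (n + 1) → Fin m → ℕ,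
      (momentMatrix a b (∑ l ∈ occupationsLE m n, c l • fockState l)).det ≠ 0 := by
  have h (i : Fin (n + 1)) : ∃ a : Fin m → ℕ, a ≤ k ∧ ∑ l, a l = i :=
    exists_le_sum_eq k (by omega)
  choose a hak ha using h
  have hb (j : Fin (n + 1)) : ∑ l, (k - a j) l + j = n := by
    rw [← ha j, ← hk, ← Finset.sum_add_distrib]
    exact Finset.sum_congr rfl fun l _ => Nat.sub_add_cancel (hak j l)
  -- The index `a i + (k - a j)` has degree `n + i - j`: it is `k` itself when `i = j`, and has
  -- degree above `n` when `j < i`.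
  refine ⟨a, fun j => k - a j, ?_⟩
  rw [Matrix.det_of_isUpperTriangular, Finset.prod_ne_zero_iff]
  · intro i _
    simp only [momentMatrix, Matrix.of_apply, bargmannMoment, add_tsub_cancel_of_le (hak i),
      sum_smul_fockState_apply, mem_occupationsLE, hk, le_refl, if_true]
    refine mul_ne_zero (Finset.prod_ne_zero_iff.2 fun l _ => ?_) hck
    exact Complex.ofReal_ne_zero.2 (Real.sqrt_ne_zero'.2 (by positivity))
  · intro i j hij
    have hij' : (j : ℕ) < i := hij
    have hsum : ¬ ∑ l, (a i + (k - a j)) l ≤ n := by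
      have := hb j
      simp only [Pi.add_apply, Finset.sum_add_distrib, ha i]
      omega
    rw [momentMatrix, Matrix.of_apply, bargmannMoment, sum_smul_fockState_apply,
      if_neg (by rwa [mem_occupationsLE]), mul_zero]

/-- Correcting the phase of `φ` bounds the distance of two states by their infidelity. -/
theorem norm_inner_smul_sub_sq {m : ℕ} {ψ φ : FockSpace m} (hψ : ‖ψ‖ = 1) (hφ : ‖φ‖ = 1) :
    ‖inner ℂ φ ψ • φ - ψ‖ ^ 2 = 1 - fidelity ψ φ := by
  rw [@norm_sub_sq ℂ, inner_smul_left, norm_smul, hψ, hφ, RCLike.conj_mul, fidelity,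
    norm_inner_symm ψ φ, ← RCLike.ofReal_pow, RCLike.ofReal_re]
  ring

/-- Superpositions of `r` coherent states are stable under scalars, so the approximant may be
replaced by the projection of `ψ` onto its line, turning high fidelity into norm convergence. -/
theorem IsApproxByCoherent.mem_closure {m r : ℕ} {ψ : FockSpace m} (hψ : ‖ψ‖ = 1)
    (h : IsApproxByCoherent ψ r) :
    ψ ∈ closure {x | ∃ (c : Fin r → ℂ) (α : Fin r → Fin m → ℂ),
      x = ∑ j, c j • coherentState (α j)} := by
  refine Metric.mem_closure_iff.2 fun δ hδ => ?_
  -- The squared distance equals the infidelity; the factor 1/2 makes the bound by `δ ^ 2` strict.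
  obtain ⟨c, α, φ, hφ, hφ₁, hF⟩ := h (δ ^ 2 / 2) (by positivity)
  refine ⟨inner ℂ φ ψ • φ, ⟨fun j => inner ℂ φ ψ * c j, α, ?_⟩, ?_⟩
  · conv_lhs => rw [hφ, Finset.smul_sum]
    simp only [smul_smul, ← hφ]
  · rw [dist_comm, dist_eq_norm]
    refine lt_of_pow_lt_pow_left₀ 2 hδ.le ?_
    rw [norm_inner_smul_sub_sq hψ hφ₁]
    have : 0 < δ ^ 2 := by positivity
    linarith

end

theorem theorem3 (m n : ℕ) (c : (Fin m → ℕ) → ℂ) (ψ : FockSpace m)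
    (hψ : ψ = ∑ k ∈ occupationsLE m n, c k • fockState k)
    (hnorm : ‖ψ‖ = 1)
    (hc : ∃ k : Fin m → ℕ, ∑ i, k i = n ∧ c k ≠ 0) :
    (n : ℕ∞) + 1 ≤ approxCoherentStateRank ψ := by
  obtain ⟨k, hk, hck⟩ := hc
  obtain ⟨a, b, hdet⟩ := exists_det_momentMatrix_ne_zero c hk hck
  rw [← hψ] at hdet
  refine le_iInf₂ fun r hr => ?_
  by_contra hlt
  have hrn : r < n + 1 := by exact_mod_cast not_le.1 hlt
  refine hdet (closure_minimal ?_ (isClosed_singleton.preimage (continuous_det_momentMatrix a b))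
    (hr.mem_closure hnorm))
  rintro _ ⟨c', α, rfl⟩
  exact det_momentMatrix_eq_zero hrn a b c' α
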